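/- Let $A,B,C,D$ be real matrices of sizes $m\times m$, $m\times n$, $n\times m$, $n\times n$, and let \[ K=\begin{bmatrix} D & -C\\ -B & A\end{bmatrix},\qquad H=\begin{bmatrix} D & -C\\ B & -A\end{bmatrix}. \] Inequalities between matrices or vectors are entrywise. A real square matrix with nonpositive off-diagonal entries is an $M$-matrix if it can be written as $sI-N$ with $N\ge 0$ and $s\ge\rho(N)$, where $\rho$ is the spectral radius; an $M$-matrix $M$ is regular if $Mv\ge 0$ for some vector $v>0$. Assume that $K$ is a regular $M$-matrix. Then the equations \[ XCX-XD-AX+B=0 \qquad\text{and}\qquad YBY-YA-DY+C=0 \] have minimal (that is, entrywise least) nonnegative solutions $\Phi$ and $\Psi$, respectively. Let the eigenvalues of $H$, counted with algebraic multiplicity, be arranged in descending order of their real parts as $\lambda_1,\ldots,\lambda_n,\lambda_{n+1},\ldots,\lambda_{n+m}$ (ties ordered arbitrarily). Then, with algebraic multiplicities, the eigenvalues of $D-C\Phi$ are $\lambda_1,\ldots,\lambda_n$ and the eigenvalues of $A-B\Psi$ are $-\lambda_{n+1},\ldots,-\lambda_{n+m}$. In particular, $\lambda_n$ (if $n\ge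 1$) and $\lambda_{n+1}$ (if $m\ge 1$) are real numbers. -/

import Mathlib

namespace RiccatiM

/-- A real square matrix is a `Z`-matrix if all its off-diagonal entries are nonpositive. -/
def IsZMatrix {ι : Type*} (M : Matrix ι ι ℝ) : Prop :=
  ∀ i j, i ≠ j → M i j ≤ 0

/-- An `M`-matrix: a `Z`-matrix of the form `s I - N` with `N ≥ 0` entrywise and `s ≥ ρ(N)`.
The spectral radius `ρ(N)` is that of `N` as a complex matrix. -/
def IsMMatrix {ι : Type*} [Fintype ι] [DecidableEq ι] (M : Matrix ι ι ℝ) : Prop :=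
  IsZMatrix M ∧ ∃ (s : ℝ) (N : Matrix ι ι ℝ), 0 ≤ s ∧ (∀ i j, 0 ≤ N i j) ∧
    M = s • (1 : Matrix ι ι ℝ) - N ∧
    spectralRadius ℂ (N.map (algebraMap ℝ ℂ)) ≤ ENNReal.ofReal s

/-- An `M`-matrix `M` is regular if `M v ≥ 0` for some entrywise positive vector `v`. -/
def IsRegularMMatrix {ι : Type*} [Fintype ι] [DecidableEq ι] (M : Matrix ι ι ℝ) : Prop :=
  IsMMatrix M ∧ ∃ v : ι → ℝ, (∀ i, 0 < v i) ∧ ∀ i, 0 ≤ M.mulVec v i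

/-- `X` is an entrywise nonnegative solution of the Riccati equation
`X C X - X D - A X + B = 0`. -/
def IsNonnegSolution {n m : ℕ} (A : Matrix (Fin m) (Fin m) ℝ) (B : Matrix (Fin m) (Fin n) ℝ)
    (C : Matrix (Fin n) (Fin m) ℝ) (D : Matrix (Fin n) (Fin n) ℝ)
    (X : Matrix (Fin m) (Fin n) ℝ) : Prop :=
  (∀ i j, 0 ≤ X i j) ∧ X * C * X - X * D - A * X + B = 0

/-- The minimal nonnegative solution of `X C X - X D - A X + B = 0`: the entrywise least element
of the set of nonnegative solutions (hence unique if it exists). -/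
def IsMinimalNonnegSolution {n m : ℕ} (A : Matrix (Fin m) (Fin m) ℝ)
    (B : Matrix (Fin m) (Fin n) ℝ) (C : Matrix (Fin n) (Fin m) ℝ) (D : Matrix (Fin n) (Fin n) ℝ)
    (X : Matrix (Fin m) (Fin n) ℝ) : Prop :=
  IsNonnegSolution A B C D X ∧ ∀ Y, IsNonnegSolution A B C D Y → ∀ i j, X i j ≤ Y i j

/-- The complex eigenvalues of a real square matrix, with algebraic multiplicity. -/
noncomputable def eigenvalueMultiset {ι : Type*} [Fintype ι] [DecidableEq ι]
    (M : Matrix ι ι ℝ) : Multiset ℂ :=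
  (M.map (algebraMap ℝ ℂ)).charpoly.roots

end RiccatiM

/-!
The vector `v = (v₁, v₂) > 0` with `K v ≥ 0` does most of the work. Since `K` is a Z-matrix,
`B, C ≥ 0` and `A, D` are Z-matrices, and `K v ≥ 0` says `C v₂ ≤ D v₁` and `B v₁ ≤ A v₂`. A monotone
fixed point iteration started at `0`, whose iterates `X` satisfy `X v₁ ≤ v₂`, converges to the least
nonnegative solution `Φ` (`exists_least_solution`); the same applies to `Ψ`.

Every solution of either equation makes `H` similar to a block triangular matrix. Thus the spectrum
of `H` is that of `D - C Φ` together with the negative of that of `A - Φ C`, and also that of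
`D - Ψ B` together with the negative of that of `A - B Ψ`. All four of these matrices are Z-matrices
with spectrum in the open right half plane together with `0`:
* `D - C Φ` maps `v₁ > 0` to a nonnegative vector, so weighted Gershgorin discs, tangent to the
  imaginary axis at `0`, contain its eigenvalues (`IsZMatrix.norm_sub_le`); similarly `A - B Ψ`.
* `A - Φ C` maps `v₂ - Φ v₁ ≥ 0` to a nonnegative vector, but that vector may have zero entries. It
  becomes positive when `K` is replaced by `K + ε I`, and the minimal solutions of the perturbed
  equations increase to `Φ` as `ε` decreases to `0` (`exists_norm_sub_le_of_least`); similarly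
  `D - Ψ B`.

Such a splitting of the spectrum into `n` numbers on the right and `m` on the left is unique,
because `0` is the only possible point on the imaginary axis (`eq_and_eq_of_add_eq_add`). Hence
`A - Φ C` and `A - B Ψ` have the same eigenvalues, even where `I - Φ Ψ` is singular, and the
arrangement by real parts yields the same splitting (`map_antitone_eq`). Finally, an eigenvalue of
least real part of a Z-matrix is real, by a weak form of the Perron–Frobenius theorem
(`IsZMatrix.exists_real_eigenvalue`).
-/

namespace RiccatiM

open Matrix Filter Topology

/-! ### Monotonicity and eigenvalues of Z-matrices -/

section ZMatrices

variable {ι κ : Type*} [Fintype κ]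

lemma mulVec_nonneg {M : Matrix ι κ ℝ} {x : κ → ℝ} (hM : ∀ i j, 0 ≤ M i j) (hx : ∀ j, 0 ≤ x j)
    (i : ι) : 0 ≤ (M *ᵥ x) i :=
  Finset.sum_nonneg fun j _ => mul_nonneg (hM i j) (hx j)

variable [Fintype ι]

lemma IsZMatrix.mulVec_nonpos {M : Matrix ι ι ℝ} (hM : IsZMatrix M) {w : ι → ℝ}
    (hw : ∀ i, 0 ≤ w i) {i : ι} (hi : w i = 0) : (M *ᵥ w) i ≤ 0 := by
  refine Finset.sum_nonpos fun j _ => ?_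
  by_cases h : i = j
  · subst h; simp [hi]
  · exact mul_nonpos_of_nonpos_of_nonneg (hM i j h) (hw j)

lemma IsZMatrix.pos_of_mulVec_pos {M : Matrix ι ι ℝ} (hM : IsZMatrix M) {w : ι → ℝ}
    (hw : ∀ i, 0 ≤ w i) (h : ∀ i, 0 < (M *ᵥ w) i) (i : ι) : 0 < w i := by
  refine lt_of_le_of_ne (hw i) fun h0 => ?_
  exact (hM.mulVec_nonpos hw h0.symm).not_gt (h i)

/-- A Z-matrix that maps some positive vector to a positive vector is inverse-nonnegative. The
proof subtracts from `x` the multiple of `u` given by the least ratio `x i / u i`. -/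
lemma IsZMatrix.nonneg_of_mulVec_nonneg {M : Matrix ι ι ℝ} (hM : IsZMatrix M) {u x : ι → ℝ}
    (hu : ∀ i, 0 < u i) (hMu : ∀ i, 0 < (M *ᵥ u) i) (hx : ∀ i, 0 ≤ (M *ᵥ x) i) (i : ι) :
    0 ≤ x i := by
  have : Nonempty ι := ⟨i⟩
  obtain ⟨k, hk⟩ := Finite.exists_min fun j => x j / u j
  set r := x k / u k with hr
  have hw : ∀ j, 0 ≤ (x - r • u) j := fun j => by
    have := (le_div_iff₀ (hu j)).1 (hk j)
    simpa using this
  have hwk : (x - r • u) k = 0 := by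
    simp [hr, div_mul_cancel₀ _ (hu k).ne']
  have h1 := hM.mulVec_nonpos hw hwk
  rw [mulVec_sub, mulVec_smul] at h1
  have h2 : (M *ᵥ x) k - r * (M *ᵥ u) k ≤ 0 := by simpa using h1
  have hr0 : 0 ≤ r := by
    by_contra! h
    have := mul_neg_of_neg_of_pos h (hMu k)
    have := hx k
    linarith
  have h3 := (le_div_iff₀ (hu i)).1 (hk i)
  have := mul_nonneg hr0 (hu i).le
  linarith

variable [DecidableEq ι]

lemma mem_eigenvalueMultiset_iff {M : Matrix ι ι ℝ} {z : ℂ} :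
    z ∈ eigenvalueMultiset M ↔ (M.map (algebraMap ℝ ℂ)).charpoly.eval z = 0 :=
  Polynomial.mem_roots (charpoly_monic _).ne_zero

lemma exists_eigenvector_of_mem {M : Matrix ι ι ℝ} {z : ℂ} (hz : z ∈ eigenvalueMultiset M) :
    ∃ x : ι → ℂ, x ≠ 0 ∧ M.map (algebraMap ℝ ℂ) *ᵥ x = z • x := by
  rw [mem_eigenvalueMultiset_iff, eval_charpoly, ← exists_mulVec_eq_zero_iff] at hz
  obtain ⟨x, hx0, hx⟩ := hz
  refine ⟨x, hx0, ?_⟩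
  rw [sub_mulVec, sub_eq_zero] at hx
  rw [← hx]
  ext i
  simp [scalar_apply, mulVec_diagonal]

lemma card_eigenvalueMultiset (M : Matrix ι ι ℝ) :
    Multiset.card (eigenvalueMultiset M) = Fintype.card ι := by
  rw [eigenvalueMultiset, Polynomial.splits_iff_card_roots.1 (IsAlgClosed.splits _),
    charpoly_natDegree_eq_dim]

lemma ofReal_mem_eigenvalueMultiset_iff {M : Matrix ι ι ℝ} {a : ℝ} :
    (a : ℂ) ∈ eigenvalueMultiset M ↔ (M - a • 1).det = 0 := by
  rw [mem_eigenvalueMultiset_iff, charpoly_map]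
  rw [← Complex.coe_algebraMap, Polynomial.eval_map_algebraMap, Polynomial.aeval_algebraMap_apply,
    Complex.coe_algebraMap, Complex.ofReal_eq_zero, Polynomial.coe_aeval_eq_eval, eval_charpoly,
    ← neg_sub, det_neg]
  rw [smul_one_eq_diagonal]
  simp

/-- A weighted Gershgorin disc: it touches the line `Re z = a` at the real point `a` only. -/
lemma IsZMatrix.norm_sub_le {M : Matrix ι ι ℝ} (hM : IsZMatrix M) {u : ι → ℝ}
    (hu : ∀ i, 0 < u i) {a c : ℝ} (hMu : ∀ i, a * u i ≤ (M *ᵥ u) i) (hc : ∀ i, M i i ≤ c)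
    {z : ℂ} (hz : z ∈ eigenvalueMultiset M) : ‖z - c‖ ≤ c - a := by
  obtain ⟨x, hx0, hx⟩ := exists_eigenvector_of_mem hz
  obtain ⟨i₀, hi₀⟩ := Function.ne_iff.1 hx0
  have : Nonempty ι := ⟨i₀⟩
  obtain ⟨k, hk⟩ := Finite.exists_max fun j => ‖x j‖ / u j
  set r := ‖x k‖ / u k with hr
  have hxr : ∀ j, ‖x j‖ ≤ r * u j := fun j => (div_le_iff₀ (hu j)).1 (hk j)
  have hxk : ‖x k‖ = r * u k := by rw [hr, div_mul_cancel₀ _ (hu k).ne']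
  have hr0 : 0 < r := by
    have h1 : 0 < ‖x i₀‖ := norm_pos_iff.2 hi₀
    have := hxr i₀
    exact pos_of_mul_pos_left (h1.trans_le this) (hu i₀).le
  -- `c • 1 - M` is entrywise nonnegative
  set N : Matrix ι ι ℝ := c • 1 - M with hN
  have hN0 : ∀ i j, 0 ≤ N i j := fun i j => by
    by_cases h : i = j
    · subst h; simpa [hN] using hc i
    · simpa [hN, h] using hM i j h
  have hNu : (N *ᵥ u) k ≤ (c - a) * u k := by
    have := hMu k
    simp only [hN, sub_mulVec, smul_mulVec, one_mulVec, Pi.sub_apply, Pi.smul_apply, smul_eq_mul]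
    linarith
  have hNx : ∑ j, (N k j : ℂ) * x j = (c - z) * x k := by
    have h1 := congrFun hx k
    simp only [mulVec, dotProduct, Matrix.map_apply, Complex.coe_algebraMap, Pi.smul_apply,
      smul_eq_mul] at h1
    rw [sub_mul, ← h1]
    simp [hN, sub_mul, Finset.sum_sub_distrib, Matrix.one_apply, apply_ite Complex.ofReal]
  have h2 : ‖z - c‖ * ‖x k‖ ≤ (c - a) * u k * r := by
    rw [norm_sub_rev, ← norm_mul, ← hNx]
    calc ‖∑ j, (N k j : ℂ) * x j‖ ≤ ∑ j, N k j * u j * r := by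
          refine (norm_sum_le _ _).trans (Finset.sum_le_sum fun j _ => ?_)
          rw [norm_mul, Complex.norm_real, Real.norm_of_nonneg (hN0 k j), mul_assoc, mul_comm (u j)]
          exact mul_le_mul_of_nonneg_left (hxr j) (hN0 k j)
      _ = (N *ᵥ u) k * r := by rw [← Finset.sum_mul]; rfl
      _ ≤ _ := mul_le_mul_of_nonneg_right hNu hr0.le
  rw [hxk] at h2
  have h3 : 0 < r * u k := mul_pos hr0 (hu k)
  refine le_of_mul_le_mul_right ?_ h3
  linarith

lemma re_pos_or_eq_zero_of_norm_sub_le {z : ℂ} {c : ℝ} (h : ‖z - c‖ ≤ c) : 0 < z.re ∨ z = 0 := by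
  have hc : 0 ≤ c := (norm_nonneg _).trans h
  have h2 : ‖z - c‖ ^ 2 ≤ c ^ 2 := by gcongr
  rw [← Complex.normSq_eq_norm_sq, Complex.normSq_apply] at h2
  simp only [Complex.sub_re, Complex.ofReal_re, Complex.sub_im, Complex.ofReal_im, sub_zero] at h2
  by_cases h0 : 0 < z.re
  · exact Or.inl h0
  · right
    push Not at h0
    have : 0 ≤ -(c * z.re) := by nlinarith
    apply Complex.ext <;> simp <;> nlinarith [sq_nonneg z.re, sq_nonneg z.im]

/-- The weak Perron–Frobenius theorem for Z-matrices: the spectrum lies in a disc whose leftmost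
point is a real eigenvalue. That eigenvalue is the supremum of the `a` for which `M - a • 1` maps
some positive vector to a positive vector. -/
lemma IsZMatrix.exists_real_eigenvalue [Nonempty ι] {M : Matrix ι ι ℝ} (hM : IsZMatrix M) :
    ∃ a c : ℝ, (a : ℂ) ∈ eigenvalueMultiset M ∧ ∀ z ∈ eigenvalueMultiset M, ‖z - c‖ ≤ c - a := by
  let S : Set ℝ := {a | ∃ u : ι → ℝ, (∀ i, 0 < u i) ∧ ∀ i, a * u i < (M *ᵥ u) i}
  obtain ⟨k, hc⟩ := Finite.exists_max fun j => M j j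
  set c := M k k
  obtain ⟨l, hl⟩ := Finite.exists_min fun j => (M *ᵥ 1) j
  have hne : S.Nonempty := by
    refine ⟨(M *ᵥ 1) l - 1, 1, fun _ => one_pos, fun i => ?_⟩
    have := hl i
    simp only [Pi.one_apply]
    linarith
  have hbdd : BddAbove S := by
    refine ⟨c, ?_⟩
    rintro a ⟨u, hu, h⟩
    have h1 : (M *ᵥ u) k ≤ c * u k := by
      rw [mulVec, dotProduct, ← Finset.add_sum_erase _ _ (Finset.mem_univ k)]
      refine add_le_of_nonpos_right (Finset.sum_nonpos fun j hj => ?_)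
      exact mul_nonpos_of_nonpos_of_nonneg (hM k j (Finset.ne_of_mem_erase hj).symm) (hu j).le
    exact (lt_of_mul_lt_mul_right ((h k).trans_le h1) (hu k).le).le
  set a := sSup S
  have hlt : ∀ b < a, b ∈ S := fun b hb => by
    obtain ⟨b', ⟨u, hu, h⟩, hb'⟩ := exists_lt_of_lt_csSup hne hb
    exact ⟨u, hu, fun i => (mul_lt_mul_of_pos_right hb' (hu i)).trans (h i)⟩
  have hnot : a ∉ S := by
    rintro ⟨u, hu, h⟩
    have h1 : ∀ᶠ b in 𝓝[>] a, ∀ i, b * u i < (M *ᵥ u) i := by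
      refine eventually_all.2 fun i => ?_
      have : Tendsto (fun b : ℝ => b * u i) (𝓝[>] a) (𝓝 (a * u i)) :=
        (tendsto_id.mul_const _).mono_left nhdsWithin_le_nhds
      exact this.eventually_lt_const (h i)
    obtain ⟨b, hb, hab⟩ := (h1.and self_mem_nhdsWithin).exists
    exact (le_csSup hbdd (⟨u, hu, hb⟩ : b ∈ S)).not_gt hab
  have hsub : ∀ (b : ℝ) (u : ι → ℝ) (i : ι),
      ((M - b • 1) *ᵥ u) i = (M *ᵥ u) i - b * u i := fun b u i => by
    simp [sub_mulVec, smul_mulVec]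
  have hZ : ∀ b : ℝ, IsZMatrix (M - b • 1) := fun b i j hij => by simpa [hij] using hM i j hij
  refine ⟨a, c, ?_, fun z hz => ?_⟩
  · rw [ofReal_mem_eigenvalueMultiset_iff]
    by_contra hdet
    -- otherwise `(M - b • 1)⁻¹ *ᵥ 1` is nonnegative for `b < a`, hence at `a` by continuity
    refine hnot ⟨(M - a • 1)⁻¹ *ᵥ 1, ?_⟩
    have hunit : ∀ b : ℝ, (M - b • 1).det ≠ 0 →
        (M - b • 1) *ᵥ ((M - b • 1)⁻¹ *ᵥ (1 : ι → ℝ)) = 1 := fun b hb => by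
      rw [mulVec_mulVec, mul_nonsing_inv _ hb.isUnit, one_mulVec]
    have hcont : Continuous fun b : ℝ => M - b • (1 : Matrix ι ι ℝ) := by fun_prop
    have hdet' : ∀ᶠ b in 𝓝[<] a, (M - b • (1 : Matrix ι ι ℝ)).det ≠ 0 :=
      nhdsWithin_le_nhds (hcont.matrix_det.continuousAt.eventually_ne hdet)
    have hinv : ContinuousAt (fun b : ℝ => (M - b • (1 : Matrix ι ι ℝ))⁻¹) a := by
      have h1 : ContinuousAt Inv.inv (M - a • (1 : Matrix ι ι ℝ)) :=
        continuousAt_matrix_inv _ (by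
          have := NormedRing.inverse_continuousAt (Units.mk0 _ hdet)
          simpa using this)
      exact ContinuousAt.comp (f := fun b : ℝ => M - b • (1 : Matrix ι ι ℝ)) h1 hcont.continuousAt
    have hnonneg : ∀ i, 0 ≤ ((M - a • 1)⁻¹ *ᵥ (1 : ι → ℝ)) i := fun i => by
      have h1 : Tendsto (fun b : ℝ => ((M - b • (1 : Matrix ι ι ℝ))⁻¹ *ᵥ (1 : ι → ℝ)) i) (𝓝[<] a)
          (𝓝 (((M - a • 1)⁻¹ *ᵥ (1 : ι → ℝ)) i)) := by
        have hmv : Continuous fun X : Matrix ι ι ℝ => (X *ᵥ (1 : ι → ℝ)) i :=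
          (continuous_apply i).comp (continuous_id.matrix_mulVec continuous_const)
        exact (hmv.continuousAt.tendsto.comp hinv.tendsto).mono_left nhdsWithin_le_nhds
      refine ge_of_tendsto h1 ?_
      filter_upwards [hdet', self_mem_nhdsWithin] with b hb hba
      obtain ⟨u, hu, h⟩ := hlt b hba
      refine (hZ b).nonneg_of_mulVec_nonneg hu (fun j => ?_) (fun j => ?_) i
      · rw [hsub]; exact sub_pos.2 (h j)
      · rw [hunit b hb]; exact zero_le_one
    have hpos := (hZ a).pos_of_mulVec_pos hnonneg fun i => by
      rw [hunit a hdet]; exact one_pos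
    refine ⟨hpos, fun i => ?_⟩
    rw [← sub_pos, ← hsub, hunit a hdet]
    exact one_pos
  · refine le_sub_comm.1 (le_of_forall_lt fun b hb => ?_)
    obtain ⟨b', hbb', hb'⟩ := exists_between hb
    obtain ⟨u, hu, h⟩ := hlt b' hb'
    have := hM.norm_sub_le hu (fun i => (h i).le) hc hz
    linarith

end ZMatrices

/-! ### Eigenvalues of block matrices and of limits -/

section Eigenvalues
variable {ι κ : Type*} [Fintype κ] [Fintype ι] [DecidableEq ι] [DecidableEq κ]

lemma eigenvalueMultiset_eq_add {M : Matrix (ι ⊕ κ) (ι ⊕ κ) ℝ} {P : Matrix ι ι ℝ}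
    {Q : Matrix κ κ ℝ} (h : M.charpoly = P.charpoly * Q.charpoly) :
    eigenvalueMultiset M = eigenvalueMultiset P + eigenvalueMultiset Q := by
  rw [eigenvalueMultiset, eigenvalueMultiset, eigenvalueMultiset, charpoly_map, charpoly_map,
    charpoly_map, h, Polynomial.map_mul, Polynomial.roots_mul]
  rw [← Polynomial.map_mul, ← h, ← charpoly_map]
  exact (charpoly_monic _).ne_zero

lemma eigenvalueMultiset_neg (M : Matrix ι ι ℝ) :
    eigenvalueMultiset (-M) = (eigenvalueMultiset M).map fun z => -z := by
  have h : ((-M).map (algebraMap ℝ ℂ)).charpoly =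
      (-1) ^ Fintype.card ι * ((M.map (algebraMap ℝ ℂ)).charpoly.comp (-Polynomial.X)) := by
    refine Polynomial.funext fun z => ?_
    rw [Polynomial.eval_mul, Polynomial.eval_comp, eval_charpoly, eval_charpoly]
    simp only [Polynomial.eval_pow, Polynomial.eval_neg, Polynomial.eval_one, Polynomial.eval_X]
    rw [← det_neg]
    congr 1
    ext i j
    simp only [Matrix.neg_apply, Matrix.sub_apply, Matrix.map_apply, scalar_apply, map_neg,
      diagonal_apply]
    split_ifs <;> ring
  rw [eigenvalueMultiset, h, eigenvalueMultiset, ← Polynomial.roots_comp_neg_X]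
  rcases neg_one_pow_eq_or (Polynomial ℂ) (Fintype.card ι) with h1 | h1 <;> rw [h1]
  · rw [one_mul]
  · rw [neg_one_mul, Polynomial.roots_neg]

/-- A solution `X` of the Riccati equation makes `H` similar to a block upper triangular matrix. -/
lemma eigenvalueMultiset_of_solution {A : Matrix κ κ ℝ} {B : Matrix κ ι ℝ} {C : Matrix ι κ ℝ}
    {D : Matrix ι ι ℝ} {X : Matrix κ ι ℝ} (hX : X * C * X - X * D - A * X + B = 0) :
    eigenvalueMultiset (fromBlocks D (-C) B (-A)) =
      eigenvalueMultiset (D - C * X) + (eigenvalueMultiset (A - X * C)).map fun z => -z := by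
  rw [← eigenvalueMultiset_neg]
  apply eigenvalueMultiset_eq_add
  have hB : B = X * (D - C * X) + A * X := by
    rw [← sub_eq_zero, ← hX, Matrix.mul_sub, Matrix.mul_assoc]; abel
  rw [← charpoly_fromBlocks_zero₂₁ (M₁₂ := -C)]
  have h : fromBlocks D (-C) B (-A) = fromBlocks 1 0 X 1 *
      (fromBlocks (D - C * X) (-C) 0 (-(A - X * C)) * fromBlocks 1 0 (-X) 1) := by
    rw [fromBlocks_multiply, fromBlocks_multiply]
    congr 1 <;> simp [Matrix.mul_sub, Matrix.sub_mul, hB, Matrix.mul_assoc] <;> abel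
  rw [h, charpoly_mul_comm, Matrix.mul_assoc, fromBlocks_multiply]
  simp

/-- The version of `eigenvalueMultiset_of_solution` for a solution `Y` of the dual equation. -/
lemma eigenvalueMultiset_of_dual_solution {A : Matrix κ κ ℝ} {B : Matrix κ ι ℝ}
    {C : Matrix ι κ ℝ} {D : Matrix ι ι ℝ} {Y : Matrix ι κ ℝ}
    (hY : Y * B * Y - Y * A - D * Y + C = 0) :
    eigenvalueMultiset (fromBlocks D (-C) B (-A)) =
      eigenvalueMultiset (D - Y * B) + (eigenvalueMultiset (A - B * Y)).map fun z => -z := by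
  rw [← eigenvalueMultiset_neg]
  apply eigenvalueMultiset_eq_add
  have hC : C = Y * (A - B * Y) + D * Y := by
    rw [← sub_eq_zero, ← hY, Matrix.mul_sub, Matrix.mul_assoc]; abel
  rw [← charpoly_fromBlocks_zero₁₂ (M₂₁ := B)]
  have h : fromBlocks D (-C) B (-A) = fromBlocks 1 Y 0 1 *
      (fromBlocks (D - Y * B) 0 B (-(A - B * Y)) * fromBlocks 1 (-Y) 0 1) := by
    rw [fromBlocks_multiply, fromBlocks_multiply]
    congr 1 <;> simp [Matrix.mul_sub, Matrix.sub_mul, Matrix.mul_add, hC, Matrix.mul_assoc] <;> abel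
  rw [h, charpoly_mul_comm, Matrix.mul_assoc, fromBlocks_multiply]
  simp

/-- Closed discs containing the spectra of the terms of a convergent sequence contain the spectrum
of the limit: `|det (z - M k)|` is at least the distance of `z` to the disc, to the power of the
dimension. -/
lemma norm_sub_le_of_tendsto {M : ℕ → Matrix ι ι ℝ} {M' : Matrix ι ι ℝ}
    (hM : Tendsto M atTop (𝓝 M')) {w : ℂ} {c : ℝ}
    (h : ∀ k, ∀ z ∈ eigenvalueMultiset (M k), ‖z - w‖ ≤ c) {z : ℂ}
    (hz : z ∈ eigenvalueMultiset M') : ‖z - w‖ ≤ c := by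
  by_contra! hlt
  set δ := ‖z - w‖ - c with hδ
  have hδ0 : 0 < δ := sub_pos.2 hlt
  have hcont : Continuous fun N : Matrix ι ι ℝ =>
      ‖(N.map (algebraMap ℝ ℂ)).charpoly.eval z‖ := by
    simp only [eval_charpoly]
    have : Continuous (algebraMap ℝ ℂ) := Complex.continuous_ofReal
    exact (continuous_const.sub (continuous_id.matrix_map this)).matrix_det.norm
  have hlim := (hcont.tendsto M').comp hM
  rw [mem_eigenvalueMultiset_iff.1 hz, norm_zero] at hlim
  refine (pow_pos hδ0 (Fintype.card ι)).not_ge (ge_of_tendsto' hlim fun k => ?_)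
  have hs := (IsAlgClosed.splits ((M k).map (algebraMap ℝ ℂ)).charpoly).eval_eq_prod_roots_of_monic
    (charpoly_monic _) z
  rw [Function.comp_apply, hs, ← card_eigenvalueMultiset (M k), eigenvalueMultiset]
  have hroots := h k
  rw [eigenvalueMultiset] at hroots
  generalize ((M k).map (algebraMap ℝ ℂ)).charpoly.roots = s at hroots ⊢
  induction s using Multiset.induction with
  | empty => simp
  | cons a s ih =>
    rw [Multiset.card_cons, Multiset.map_cons, Multiset.prod_cons, norm_mul, pow_succ']
    have h1 : δ ≤ ‖z - a‖ := by
      have h2 := hroots a (Multiset.mem_cons_self a s)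
      have h3 := norm_sub_le_norm_sub_add_norm_sub z a w
      linarith
    exact mul_le_mul h1 (ih fun b hb => hroots b (Multiset.mem_cons_of_mem hb)) (by positivity)
      (norm_nonneg _)

end Eigenvalues

/-! ### Minimal nonnegative solutions -/

section Solutions
variable {ι κ : Type*}

lemma exists_tendsto_of_monotone {X : ℕ → Matrix κ ι ℝ} {Y : Matrix κ ι ℝ}
    (hmono : ∀ i j, Monotone fun k => X k i j) (hle : ∀ k i j, X k i j ≤ Y i j) :
    ∃ L : Matrix κ ι ℝ, Tendsto X atTop (𝓝 L) ∧ ∀ k i j, X k i j ≤ L i j := by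
  have hb : ∀ i j, BddAbove (Set.range fun k => X k i j) := fun i j =>
    ⟨Y i j, by rintro _ ⟨k, rfl⟩; exact hle k i j⟩
  refine ⟨Matrix.of fun i j => ⨆ k, X k i j, ?_, fun k i j => le_ciSup (hb i j) k⟩
  exact tendsto_pi_nhds.2 fun i => tendsto_pi_nhds.2 fun j =>
    tendsto_atTop_ciSup (hmono i j) (hb i j)

lemma le_of_tendsto_matrix {X : ℕ → Matrix κ ι ℝ} {L Y : Matrix κ ι ℝ}
    (h : Tendsto X atTop (𝓝 L)) (hle : ∀ k i j, X k i j ≤ Y i j) (i : κ) (j : ι) :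
    L i j ≤ Y i j :=
  le_of_tendsto' (tendsto_pi_nhds.1 (tendsto_pi_nhds.1 h i) j) fun k => hle k i j

lemma mul_nonneg_entrywise {l m n : Type*} [Fintype m] {P : Matrix l m ℝ} {Q : Matrix m n ℝ}
    (hP : ∀ i j, 0 ≤ P i j) (hQ : ∀ i j, 0 ≤ Q i j) (i : l) (j : n) : 0 ≤ (P * Q) i j :=
  Finset.sum_nonneg fun k _ => mul_nonneg (hP i k) (hQ k j)

lemma mul_le_mul_entrywise {l m n : Type*} [Fintype m] {P P' : Matrix l m ℝ} {Q Q' : Matrix m n ℝ}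
    (hP : ∀ i j, P i j ≤ P' i j) (hQ : ∀ i j, Q i j ≤ Q' i j) (hP' : ∀ i j, 0 ≤ P' i j)
    (hQ0 : ∀ i j, 0 ≤ Q i j) (i : l) (j : n) : (P * Q) i j ≤ (P' * Q') i j :=
  Finset.sum_le_sum fun k _ => mul_le_mul (hP i k) (hQ k j) (hQ0 k j) (hP' i k)

lemma mulVec_le_mulVec {m n : Type*} [Fintype n] {P : Matrix m n ℝ} {x y : n → ℝ}
    (hP : ∀ i j, 0 ≤ P i j) (h : ∀ j, x j ≤ y j) (i : m) : (P *ᵥ x) i ≤ (P *ᵥ y) i :=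
  Finset.sum_le_sum fun j _ => mul_le_mul_of_nonneg_left (h j) (hP i j)

variable [Fintype ι] [Fintype κ] [DecidableEq ι] [DecidableEq κ]

/-- Writing `A = α - A'` and `D = α - D'` with `A', D' ≥ 0` turns the Riccati equation into the
fixed point equation `2 α X = X C X + X D' + A' X + B`, whose right side is monotone in `X ≥ 0`;
the least solution is the limit of the iterates starting at `0`. Each iterate satisfies
`X *ᵥ v₁ ≤ v₂`, and is below every supersolution. -/
lemma exists_least_solution {A : Matrix κ κ ℝ} {B : Matrix κ ι ℝ} {C : Matrix ι κ ℝ}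
    {D : Matrix ι ι ℝ} (hA : IsZMatrix A) (hD : IsZMatrix D) (hB : ∀ i j, 0 ≤ B i j)
    (hC : ∀ i j, 0 ≤ C i j) {v₁ : ι → ℝ} {v₂ : κ → ℝ} (hv₁ : ∀ i, 0 < v₁ i) (hv₂ : ∀ i, 0 < v₂ i)
    (h₁ : ∀ i, (C *ᵥ v₂) i ≤ (D *ᵥ v₁) i) (h₂ : ∀ i, (B *ᵥ v₁) i ≤ (A *ᵥ v₂) i) :
    ∃ X : Matrix κ ι ℝ, (∀ i j, 0 ≤ X i j) ∧ X * C * X - X * D - A * X + B = 0 ∧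
      (∀ i, (X *ᵥ v₁) i ≤ v₂ i) ∧
      ∀ Y : Matrix κ ι ℝ, (∀ i j, 0 ≤ Y i j) →
        (∀ i j, (Y * C * Y - Y * D - A * Y + B) i j ≤ 0) → ∀ i j, X i j ≤ Y i j := by
  obtain ⟨α, hα, hαA, hαD⟩ : ∃ α : ℝ, 0 < α ∧ (∀ i, A i i ≤ α) ∧ ∀ i, D i i ≤ α := by
    obtain ⟨a, ha⟩ := (Set.finite_range fun i => A i i).bddAbove
    obtain ⟨d, hd⟩ := (Set.finite_range fun i => D i i).bddAbove
    exact ⟨max 1 (max a d), lt_max_of_lt_left one_pos,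
      fun i => le_max_of_le_right (le_max_of_le_left (ha ⟨i, rfl⟩)),
      fun i => le_max_of_le_right (le_max_of_le_right (hd ⟨i, rfl⟩))⟩
  set A' : Matrix κ κ ℝ := α • 1 - A with hA'
  set D' : Matrix ι ι ℝ := α • 1 - D with hD'
  have hA'0 : ∀ i j, 0 ≤ A' i j := fun i j => by
    by_cases h : i = j
    · subst h; simpa [hA'] using hαA i
    · simpa [hA', h] using hA i j h
  have hD'0 : ∀ i j, 0 ≤ D' i j := fun i j => by
    by_cases h : i = j
    · subst h; simpa [hD'] using hαD i
    · simpa [hD', h] using hD i j h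
  let F : Matrix κ ι ℝ → Matrix κ ι ℝ := fun X => X * C * X + X * D' + A' * X + B
  have hF : ∀ X, X * C * X - X * D - A * X + B = F X - (2 * α) • X := fun X => by
    simp only [F, hA', hD', Matrix.mul_sub, Matrix.sub_mul, Matrix.mul_smul, Matrix.smul_mul,
      Matrix.mul_one, Matrix.one_mul, two_mul, add_smul]
    abel
  have hFmono : ∀ X Y : Matrix κ ι ℝ, (∀ i j, 0 ≤ X i j) → (∀ i j, X i j ≤ Y i j) →
      ∀ i j, F X i j ≤ F Y i j := fun X Y hX hXY i j => by
    have hY : ∀ i j, 0 ≤ Y i j := fun i j => (hX i j).trans (hXY i j)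
    have e1 := mul_le_mul_entrywise (mul_le_mul_entrywise hXY (fun i j => le_refl (C i j)) hY hC)
      hXY (mul_nonneg_entrywise hY hC) hX i j
    have e2 := mul_le_mul_entrywise hXY (fun i j => le_refl (D' i j)) hY hD'0 i j
    have e3 := mul_le_mul_entrywise (fun i j => le_refl (A' i j)) hXY hA'0 hX i j
    simp only [F, Matrix.add_apply]
    linarith
  have hF0 : F 0 = B := by simp [F]
  have hα2 : 0 < 2 * α := by linarith
  let X : ℕ → Matrix κ ι ℝ := fun k => (fun Y => (2 * α)⁻¹ • F Y)^[k] 0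
  have hXs : ∀ k, X (k + 1) = (2 * α)⁻¹ • F (X k) := fun k => Function.iterate_succ_apply' _ k 0
  have hstep : ∀ k i j, 2 * α * X (k + 1) i j = F (X k) i j := fun k i j => by
    rw [hXs, Matrix.smul_apply, smul_eq_mul, mul_inv_cancel_left₀ hα2.ne']
  have hXmono : ∀ k, (∀ i j, 0 ≤ X k i j) ∧ ∀ i j, X k i j ≤ X (k + 1) i j := fun k => by
    induction k with
    | zero =>
      refine ⟨fun i j => le_rfl, fun i j => ?_⟩
      rw [hXs, Matrix.smul_apply]
      change (0 : ℝ) ≤ (2 * α)⁻¹ • F 0 i j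
      rw [hF0]
      exact mul_nonneg (by positivity) (hB i j)
    | succ k ih =>
      refine ⟨fun i j => (ih.1 i j).trans (ih.2 i j), fun i j => ?_⟩
      refine le_of_mul_le_mul_left ?_ hα2
      rw [hstep, hstep]
      exact hFmono _ _ ih.1 ih.2 i j
  -- this invariant bounds the iterates and passes to the limit
  have hXv : ∀ k i, (X k *ᵥ v₁) i ≤ v₂ i := fun k => by
    induction k with
    | zero => intro i; simpa [X] using (hv₂ i).le
    | succ k ih =>
      intro i
      have hX0 := (hXmono k).1
      have e0 : 2 * α * (X (k + 1) *ᵥ v₁) i = (F (X k) *ᵥ v₁) i := by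
        rw [hXs, smul_mulVec, Pi.smul_apply, smul_eq_mul, mul_inv_cancel_left₀ hα2.ne']
      have e1 : (X k *ᵥ (C *ᵥ (X k *ᵥ v₁))) i ≤ (X k *ᵥ (D *ᵥ v₁)) i :=
        mulVec_le_mulVec hX0 (fun j => (mulVec_le_mulVec hC ih j).trans (h₁ j)) i
      have e2 : (X k *ᵥ (D' *ᵥ v₁)) i = α * (X k *ᵥ v₁) i - (X k *ᵥ (D *ᵥ v₁)) i := by
        simp [hD', sub_mulVec, smul_mulVec, mulVec_sub, mulVec_smul]
      have e3 : (A' *ᵥ (X k *ᵥ v₁)) i ≤ α * v₂ i - (A *ᵥ v₂) i := by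
        refine (mulVec_le_mulVec hA'0 ih i).trans_eq ?_
        simp [hA', sub_mulVec, smul_mulVec]
      have e4 : (F (X k) *ᵥ v₁) i = (X k *ᵥ (C *ᵥ (X k *ᵥ v₁))) i + (X k *ᵥ (D' *ᵥ v₁)) i +
          (A' *ᵥ (X k *ᵥ v₁)) i + (B *ᵥ v₁) i := by
        simp only [F, add_mulVec, mulVec_mulVec, Pi.add_apply, Matrix.mul_assoc]
      have e5 := h₂ i
      have e6 := mul_le_mul_of_nonneg_left (ih i) hα.le
      refine le_of_mul_le_mul_left ?_ hα2
      linarith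
  have hXle : ∀ Y : Matrix κ ι ℝ, (∀ i j, 0 ≤ Y i j) →
      (∀ i j, (Y * C * Y - Y * D - A * Y + B) i j ≤ 0) → ∀ k i j, X k i j ≤ Y i j := by
    intro Y hY hYs k
    induction k with
    | zero => exact hY
    | succ k ih =>
      intro i j
      have e1 := hFmono _ _ (hXmono k).1 ih i j
      have e2 := hYs i j
      rw [hF, Matrix.sub_apply, Matrix.smul_apply, smul_eq_mul] at e2
      refine le_of_mul_le_mul_left ?_ hα2
      rw [hstep]
      linarith
  obtain ⟨L, hL, hXL⟩ := exists_tendsto_of_monotone (X := X)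
    (Y := Matrix.of fun i j => v₂ i / v₁ j) (fun i j => monotone_nat_of_le_succ fun k =>
      (hXmono k).2 i j) fun k i j => by
    rw [Matrix.of_apply, le_div_iff₀ (hv₁ j)]
    refine le_trans ?_ (hXv k i)
    exact Finset.single_le_sum (f := fun j => X k i j * v₁ j)
      (fun j _ => mul_nonneg ((hXmono k).1 i j) (hv₁ j).le) (Finset.mem_univ j)
  refine ⟨L, fun i j => ((hXmono 0).1 i j).trans (hXL 0 i j), ?_, fun i => ?_, fun Y hY hYs =>
    le_of_tendsto_matrix hL (hXle Y hY hYs)⟩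
  · have hFc : Continuous F := by
      have hid : Continuous fun X : Matrix κ ι ℝ => X := continuous_id
      exact ((((hid.matrix_mul continuous_const).matrix_mul hid).add
        (hid.matrix_mul continuous_const)).add (continuous_const.matrix_mul hid)).add
        continuous_const
    have e1 : Tendsto (fun k => X (k + 1)) atTop (𝓝 ((2 * α)⁻¹ • F L)) := by
      simp only [hXs]
      exact ((hFc.tendsto L).comp hL).const_smul _
    have e2 := tendsto_nhds_unique ((tendsto_add_atTop_iff_nat 1).2 hL) e1
    rw [hF, sub_eq_zero]
    nth_rewrite 2 [e2]
    rw [smul_inv_smul₀ hα2.ne']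
  · have hc : Continuous fun X : Matrix κ ι ℝ => (X *ᵥ v₁) i :=
      (continuous_apply i).comp (continuous_id.matrix_mulVec continuous_const)
    exact le_of_tendsto' ((hc.tendsto L).comp hL) fun k => hXv k i

end Solutions

/-! ### Spectra of the closed-loop matrices -/

section ClosedLoop
variable {ι κ : Type*}

lemma IsZMatrix.sub_of_nonneg {M N : Matrix ι ι ℝ} (hM : IsZMatrix M) (hN : ∀ i j, 0 ≤ N i j) :
    IsZMatrix (M - N) := fun i j hij => sub_nonpos.2 ((hM i j hij).trans (hN i j))

variable [DecidableEq ι]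

lemma IsZMatrix.add_smul_one {M : Matrix ι ι ℝ} (hM : IsZMatrix M) (ε : ℝ) :
    IsZMatrix (M + ε • 1) := fun i j hij => by simpa [hij] using hM i j hij

variable [Fintype ι] [Fintype κ] [DecidableEq κ]

lemma riccati_add_smul_one (A : Matrix κ κ ℝ) (B : Matrix κ ι ℝ) (C : Matrix ι κ ℝ)
    (D : Matrix ι ι ℝ) (X : Matrix κ ι ℝ) (ε : ℝ) :
    X * C * X - X * (D + ε • 1) - (A + ε • 1) * X + B =
      X * C * X - X * D - A * X + B - (2 * ε) • X := by
  simp only [Matrix.mul_add, Matrix.add_mul, Matrix.mul_smul, Matrix.smul_mul, Matrix.mul_one,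
    Matrix.one_mul, two_mul, add_smul]
  abel

/-- The least solution `X` is the limit of the least solutions `X k` for `A + ε k • 1` and
`D + ε k • 1` in place of `A` and `D`, where `ε k > 0` tends to `0`. The Z-matrix
`A + ε k • 1 - X k * C` maps the vector `v₂ - X k *ᵥ v₁`, which is nonnegative, to a positive one;
without the perturbation both could have zero entries. -/
lemma exists_norm_sub_le_of_least {A : Matrix κ κ ℝ} {B : Matrix κ ι ℝ} {C : Matrix ι κ ℝ}
    {D : Matrix ι ι ℝ} (hA : IsZMatrix A) (hD : IsZMatrix D) (hB : ∀ i j, 0 ≤ B i j)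
    (hC : ∀ i j, 0 ≤ C i j) {v₁ : ι → ℝ} {v₂ : κ → ℝ} (hv₁ : ∀ i, 0 < v₁ i) (hv₂ : ∀ i, 0 < v₂ i)
    (h₁ : ∀ i, (C *ᵥ v₂) i ≤ (D *ᵥ v₁) i) (h₂ : ∀ i, (B *ᵥ v₁) i ≤ (A *ᵥ v₂) i)
    {X : Matrix κ ι ℝ} (hX0 : ∀ i j, 0 ≤ X i j) (hX : X * C * X - X * D - A * X + B = 0)
    (hmin : ∀ Y : Matrix κ ι ℝ, (∀ i j, 0 ≤ Y i j) → Y * C * Y - Y * D - A * Y + B = 0 →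
      ∀ i j, X i j ≤ Y i j) :
    ∃ c : ℝ, ∀ z ∈ eigenvalueMultiset (A - X * C), ‖z - c‖ ≤ c := by
  let ε : ℕ → ℝ := fun k => 1 / ((k : ℝ) + 1)
  have hε0 : ∀ k, 0 < ε k := fun k => Nat.one_div_pos_of_nat
  have hε1 : ∀ k, ε k ≤ 1 := fun k => by
    simpa [ε] using Nat.one_div_le_one_div (α := ℝ) (Nat.zero_le k)
  have hεs : ∀ k, ε (k + 1) ≤ ε k := fun k => Nat.one_div_le_one_div (Nat.le_succ k)
  have hε : Tendsto ε atTop (𝓝 0) := tendsto_one_div_add_atTop_nhds_zero_nat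
  have hex := fun k => exists_least_solution (hA.add_smul_one (ε k)) (hD.add_smul_one (ε k)) hB hC
    hv₁ hv₂ (fun i => by
      rw [add_mulVec, smul_mulVec, one_mulVec]
      exact (h₁ i).trans (le_add_of_nonneg_right (mul_nonneg (hε0 k).le (hv₁ i).le)))
    (fun i => by
      rw [add_mulVec, smul_mulVec, one_mulVec]
      exact (h₂ i).trans (le_add_of_nonneg_right (mul_nonneg (hε0 k).le (hv₂ i).le)))
  choose Y hY0 hY hYv hYmin using hex
  have hYr : ∀ k, Y k * C * Y k - Y k * D - A * Y k + B = (2 * ε k) • Y k := fun k => by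
    have := hY k
    rwa [riccati_add_smul_one, sub_eq_zero] at this
  have hYX : ∀ k i j, Y k i j ≤ X i j := fun k => by
    refine hYmin k X hX0 fun i j => ?_
    rw [riccati_add_smul_one, hX, zero_sub, Matrix.neg_apply, Matrix.smul_apply, smul_eq_mul,
      neg_nonpos]
    exact mul_nonneg (mul_nonneg two_pos.le (hε0 k).le) (hX0 i j)
  have hYmono : ∀ k i j, Y k i j ≤ Y (k + 1) i j := fun k => by
    refine hYmin k (Y (k + 1)) (hY0 _) fun i j => ?_
    rw [riccati_add_smul_one, hYr, ← sub_smul, Matrix.smul_apply, smul_eq_mul]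
    refine mul_nonpos_of_nonpos_of_nonneg ?_ (hY0 _ i j)
    linarith [hεs k]
  obtain ⟨L, hL, hYL⟩ := exists_tendsto_of_monotone
    (fun i j => monotone_nat_of_le_succ fun k => hYmono k i j) hYX
  have hLX : L = X := by
    have hcont : Continuous fun Z : Matrix κ ι ℝ => Z * C * Z - Z * D - A * Z + B := by
      have hid : Continuous fun Z : Matrix κ ι ℝ => Z := continuous_id
      exact ((((hid.matrix_mul continuous_const).matrix_mul hid).sub
        (hid.matrix_mul continuous_const)).sub (continuous_const.matrix_mul hid)).add
        continuous_const
    have e1 := (hcont.tendsto L).comp hL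
    have e2 : Tendsto (fun k => (2 * ε k) • Y k) atTop (𝓝 ((2 * 0 : ℝ) • L)) :=
      (hε.const_mul 2).smul hL
    simp only [Function.comp_def, hYr] at e1
    have e3 := tendsto_nhds_unique e1 e2
    rw [mul_zero, zero_smul] at e3
    ext i j
    exact le_antisymm (le_of_tendsto_matrix hL hYX i j)
      (hmin L (fun i j => (hY0 0 i j).trans (hYL 0 i j)) e3 i j)
  rw [hLX] at hL
  obtain ⟨a, ha⟩ := (Set.finite_range fun i => A i i).bddAbove
  have hlim : Tendsto (fun k => A + ε k • 1 - Y k * C) atTop (𝓝 (A - X * C)) := by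
    have e1 : Tendsto (fun k => A + ε k • (1 : Matrix κ κ ℝ)) atTop (𝓝 (A + (0 : ℝ) • 1)) :=
      tendsto_const_nhds.add (hε.smul_const _)
    rw [zero_smul, add_zero] at e1
    have hc : Continuous fun Z : Matrix κ ι ℝ => Z * C :=
      continuous_id.matrix_mul continuous_const
    exact e1.sub ((hc.tendsto X).comp hL)
  refine ⟨a + 1, fun z hz => norm_sub_le_of_tendsto hlim (fun k z hz => ?_) hz⟩
  have hYC := mul_nonneg_entrywise (hY0 k) hC
  have hZ := (hA.add_smul_one (ε k)).sub_of_nonneg hYC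
  have hpos : ∀ i, 0 < ((A + ε k • 1 - Y k * C) *ᵥ (v₂ - Y k *ᵥ v₁)) i := fun i => by
    -- the Riccati equation for `Y k`, applied to `v₁`, eliminates the terms quadratic in `Y k`
    have e2 : (A + ε k • 1 - Y k * C) *ᵥ (v₂ - Y k *ᵥ v₁) =
        ((A *ᵥ v₂ - B *ᵥ v₁) + ε k • v₂) +
          Y k *ᵥ ((D *ᵥ v₁ - C *ᵥ v₂) + ε k • v₁) := by
      have e1 : Y k *ᵥ (D *ᵥ v₁) + ε k • (Y k *ᵥ v₁) + A *ᵥ (Y k *ᵥ v₁) + ε k • (Y k *ᵥ v₁) =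
          Y k *ᵥ (C *ᵥ (Y k *ᵥ v₁)) + B *ᵥ v₁ := by
        have := congrArg (· *ᵥ v₁) (hY k)
        simp only [add_mulVec, sub_mulVec, ← mulVec_mulVec, smul_mulVec, one_mulVec, zero_mulVec,
          mulVec_smul, mulVec_add] at this
        rw [← sub_eq_zero, ← neg_eq_zero, ← this]
        abel
      rw [← sub_eq_zero] at e1 ⊢
      simp only [add_mulVec, sub_mulVec, ← mulVec_mulVec, smul_mulVec, one_mulVec, mulVec_sub,
        mulVec_smul, mulVec_add]
      rw [← neg_eq_zero, ← e1]
      abel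
    rw [e2, Pi.add_apply]
    refine add_pos_of_pos_of_nonneg ?_ (mulVec_nonneg (hY0 k) (fun j => ?_) i)
    · exact add_pos_of_nonneg_of_pos (sub_nonneg.2 (h₂ i)) (mul_pos (hε0 k) (hv₂ i))
    · exact add_nonneg (sub_nonneg.2 (h₁ j)) (mul_nonneg (hε0 k).le (hv₁ j).le)
  have hw := hZ.pos_of_mulVec_pos (fun i => sub_nonneg.2 (hYv k i)) hpos
  have hd : ∀ i, (A + ε k • 1 - Y k * C : Matrix κ κ ℝ) i i ≤ a + 1 := fun i => by
    have e1 : A i i ≤ a := ha ⟨i, rfl⟩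
    have e2 := hYC i i
    have e3 := hε1 k
    simp only [Matrix.sub_apply, Matrix.add_apply, Matrix.smul_apply, one_apply_eq, smul_eq_mul]
    linarith
  simpa using hZ.norm_sub_le hw (a := 0) (fun i => by rw [zero_mul]; exact (hpos i).le) hd hz

/-- The minimal nonnegative solution exists, and both diagonal blocks of the block triangular form
that it gives to `H` have their spectra in the open right half plane together with `0`. -/
lemma exists_minimal_solution {A : Matrix κ κ ℝ} {B : Matrix κ ι ℝ} {C : Matrix ι κ ℝ}
    {D : Matrix ι ι ℝ} (hA : IsZMatrix A) (hD : IsZMatrix D) (hB : ∀ i j, 0 ≤ B i j)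
    (hC : ∀ i j, 0 ≤ C i j) {v₁ : ι → ℝ} {v₂ : κ → ℝ} (hv₁ : ∀ i, 0 < v₁ i) (hv₂ : ∀ i, 0 < v₂ i)
    (h₁ : ∀ i, (C *ᵥ v₂) i ≤ (D *ᵥ v₁) i) (h₂ : ∀ i, (B *ᵥ v₁) i ≤ (A *ᵥ v₂) i) :
    ∃ X : Matrix κ ι ℝ, (∀ i j, 0 ≤ X i j) ∧ X * C * X - X * D - A * X + B = 0 ∧
      (∀ Y : Matrix κ ι ℝ, (∀ i j, 0 ≤ Y i j) → Y * C * Y - Y * D - A * Y + B = 0 →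
        ∀ i j, X i j ≤ Y i j) ∧
      IsZMatrix (D - C * X) ∧
      (∀ z ∈ eigenvalueMultiset (D - C * X), 0 < z.re ∨ z = 0) ∧
      ∀ z ∈ eigenvalueMultiset (A - X * C), 0 < z.re ∨ z = 0 := by
  obtain ⟨X, hX0, hX, hXv, hXmin⟩ := exists_least_solution hA hD hB hC hv₁ hv₂ h₁ h₂
  have hmin : ∀ Y : Matrix κ ι ℝ, (∀ i j, 0 ≤ Y i j) → Y * C * Y - Y * D - A * Y + B = 0 →
      ∀ i j, X i j ≤ Y i j := fun Y hY0 hY => hXmin Y hY0 fun i j => by rw [hY]; exact le_rfl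
  have hZ := hD.sub_of_nonneg (mul_nonneg_entrywise hC hX0)
  refine ⟨X, hX0, hX, hmin, hZ, fun z hz => ?_, fun z hz => ?_⟩
  · obtain ⟨c, hc⟩ := (Set.finite_range fun i => (D - C * X) i i).bddAbove
    refine re_pos_or_eq_zero_of_norm_sub_le (c := c) ?_
    simpa using hZ.norm_sub_le hv₁ (a := 0) (fun i => by
      rw [zero_mul, sub_mulVec, ← mulVec_mulVec]
      exact sub_nonneg.2 ((mulVec_le_mulVec hC hXv i).trans (h₁ i))) (fun i => hc ⟨i, rfl⟩) hz
  · obtain ⟨c, hc⟩ := exists_norm_sub_le_of_least hA hD hB hC hv₁ hv₂ h₁ h₂ hX0 hX hmin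
    exact re_pos_or_eq_zero_of_norm_sub_le (hc z hz)

end ClosedLoop

/-! ### Splitting a multiset of eigenvalues -/

lemma eq_filter_add_replicate {p : ℂ → Prop} [DecidablePred p] {P : Multiset ℂ}
    (hP : ∀ z ∈ P, p z ∨ z = 0) :
    P = P.filter p + Multiset.replicate (Multiset.card P - Multiset.card (P.filter p)) 0 := by
  have h : P.filter (fun z => ¬ p z) =
      Multiset.replicate (Multiset.card P - Multiset.card (P.filter p)) 0 := by
    refine Multiset.eq_replicate.2 ⟨?_, fun z hz => ?_⟩
    · have := congrArg Multiset.card (Multiset.filter_add_not p P)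
      rw [Multiset.card_add] at this
      omega
    · rw [Multiset.mem_filter] at hz
      exact (hP z hz.1).resolve_left hz.2
  rw [← h, Multiset.filter_add_not]

/-- A multiset of complex numbers that meets the imaginary axis in `0` only splits in just one way
into parts of given cardinality in the closed right and the closed left half plane. -/
lemma eq_and_eq_of_add_eq_add {P Q P' Q' : Multiset ℂ} (h : P + Q = P' + Q')
    (hcard : Multiset.card P = Multiset.card P') (hP : ∀ z ∈ P, 0 < z.re ∨ z = 0)
    (hP' : ∀ z ∈ P', 0 < z.re ∨ z = 0) (hQ : ∀ z ∈ Q, z.re < 0 ∨ z = 0)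
    (hQ' : ∀ z ∈ Q', z.re < 0 ∨ z = 0) : P = P' ∧ Q = Q' := by
  classical
  have h0 : ∀ R : Multiset ℂ, (∀ z ∈ R, z.re < 0 ∨ z = 0) → R.filter (fun z => 0 < z.re) = 0 :=
    fun R hR => Multiset.filter_eq_nil.2 fun z hz => by
      rcases hR z hz with h | h
      · exact h.le.not_gt
      · simp [h]
  have h1 := congrArg (Multiset.filter fun z => 0 < z.re) h
  rw [Multiset.filter_add, Multiset.filter_add, h0 Q hQ, h0 Q' hQ', add_zero, add_zero] at h1
  have hPP : P = P' := by
    rw [eq_filter_add_replicate hP, eq_filter_add_replicate hP', h1, hcard]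
  exact ⟨hPP, by rw [hPP] at h; exact add_left_cancel h⟩

lemma map_univ_fin_add {n m : ℕ} (ev : Fin (n + m) → ℂ) :
    Multiset.map ev Finset.univ.val =
      Multiset.map (fun i : Fin n => ev (Fin.castAdd m i)) Finset.univ.val +
        Multiset.map (fun j : Fin m => ev (Fin.natAdd n j)) Finset.univ.val := by
  have h : ∀ {k : ℕ} (f : Fin k → ℂ), Multiset.map f Finset.univ.val = ∑ i, {f i} := fun f => by
    rw [Finset.sum, ← Multiset.sum_map_singleton (Multiset.map f Finset.univ.val),
      Multiset.map_map]
    rfl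
  rw [h, h, h, Fin.sum_univ_add]

/-- Arranging `P + Q` by descending real part puts `P` first, if `P` lies in the open right and `Q` in
the open left half plane, up to elements `0`. The only tie between `P` and `Q` is then at `0`, so
the order of elements with equal real parts does not matter. -/
lemma map_antitone_eq {n m : ℕ} {ev : Fin (n + m) → ℂ} (hev : Antitone fun i => (ev i).re)
    {P Q : Multiset ℂ} (h : Multiset.map ev Finset.univ.val = P + Q)
    (hPn : Multiset.card P = n) (hQm : Multiset.card Q = m)
    (hP : ∀ z ∈ P, 0 < z.re ∨ z = 0) (hQ : ∀ z ∈ Q, z.re < 0 ∨ z = 0) :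
    P = Multiset.map (fun i : Fin n => ev (Fin.castAdd m i)) Finset.univ.val ∧
      Q = Multiset.map (fun j : Fin m => ev (Fin.natAdd n j)) Finset.univ.val := by
  classical
  rw [map_univ_fin_add] at h
  set L₁ := Multiset.map (fun i : Fin n => ev (Fin.castAdd m i)) Finset.univ.val with hL₁
  set L₂ := Multiset.map (fun j : Fin m => ev (Fin.natAdd n j)) Finset.univ.val with hL₂
  have hc₁ : Multiset.card L₁ = n := by simp [hL₁]
  have hc₂ : Multiset.card L₂ = m := by simp [hL₂]
  have hle : ∀ (i : Fin n) (j : Fin m), (ev (Fin.natAdd n j)).re ≤ (ev (Fin.castAdd m i)).re :=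
    fun i j => hev (by
      rw [Fin.le_def, Fin.val_castAdd, Fin.val_natAdd]
      omega)
  have hcount : ∀ (p : ℂ → Prop) [DecidablePred p],
      L₁.countP p + L₂.countP p = P.countP p + Q.countP p := fun p _ => by
    rw [← Multiset.countP_add, ← Multiset.countP_add, h]
  have hmem : ∀ z, z ∈ L₁ ∨ z ∈ L₂ → (0 < z.re ∨ z = 0) ∨ (z.re < 0 ∨ z = 0) := fun z hz => by
    rw [← Multiset.mem_add, h, Multiset.mem_add] at hz
    exact hz.imp (hP z) (hQ z)
  -- a negative real part in `L₁` would leave `m + 1` negative ones for the `m` elements of `Q`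
  have h₁ : ∀ z ∈ L₁, 0 ≤ z.re := fun z hz => by
    by_contra! hneg
    obtain ⟨i, -, rfl⟩ := Multiset.mem_map.1 hz
    have e1 : 0 < L₁.countP (fun z => z.re < 0) := Multiset.countP_pos.2 ⟨_, hz, hneg⟩
    have e2 : L₂.countP (fun z => z.re < 0) = m := by
      rw [Multiset.countP_eq_card.2, hc₂]
      intro w hw
      obtain ⟨j, -, rfl⟩ := Multiset.mem_map.1 hw
      exact (hle i j).trans_lt hneg
    have e3 : P.countP (fun z => z.re < 0) = 0 := Multiset.countP_eq_zero.2 fun w hw => by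
      rcases hP w hw with hw | hw
      · exact hw.le.not_gt
      · simp [hw]
    have e4 := Multiset.countP_le_card (fun z : ℂ => z.re < 0) Q
    have e5 := hcount fun z => z.re < 0
    omega
  have h₂ : ∀ z ∈ L₂, z.re ≤ 0 := fun z hz => by
    by_contra! hpos
    obtain ⟨j, -, rfl⟩ := Multiset.mem_map.1 hz
    have e1 : 0 < L₂.countP (fun z => 0 < z.re) := Multiset.countP_pos.2 ⟨_, hz, hpos⟩
    have e2 : L₁.countP (fun z => 0 < z.re) = n := by
      rw [Multiset.countP_eq_card.2, hc₁]
      intro w hw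
      obtain ⟨i, -, rfl⟩ := Multiset.mem_map.1 hw
      exact hpos.trans_le (hle i j)
    have e3 : Q.countP (fun z => 0 < z.re) = 0 := Multiset.countP_eq_zero.2 fun w hw => by
      rcases hQ w hw with hw | hw
      · exact hw.le.not_gt
      · simp [hw]
    have e4 := Multiset.countP_le_card (fun z : ℂ => 0 < z.re) P
    have e5 := hcount fun z => 0 < z.re
    omega
  refine eq_and_eq_of_add_eq_add h.symm (hPn.trans hc₁.symm) hP (fun z hz => ?_) hQ fun z hz => ?_
  · rcases hmem z (Or.inl hz) with h | h | h
    · exact h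
    · exact absurd h (h₁ z hz).not_gt
    · exact Or.inr h
  · rcases hmem z (Or.inr hz) with (h | h) | h
    · exact absurd h (h₂ z hz).not_gt
    · exact Or.inr h
    · exact h

/-- An eigenvalue of least real part of a Z-matrix is real. -/
lemma IsZMatrix.im_eq_zero {ι : Type*} [Fintype ι] [DecidableEq ι] {M : Matrix ι ι ℝ}
    (hM : IsZMatrix M) {f : ι → ℂ} (hf : eigenvalueMultiset M = Multiset.map f Finset.univ.val)
    {i : ι} (hi : ∀ j, (f i).re ≤ (f j).re) : (f i).im = 0 := by
  have : Nonempty ι := ⟨i⟩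
  obtain ⟨a, c, ha, hc⟩ := hM.exists_real_eigenvalue
  have h1 := hc (f i) (by rw [hf]; exact Multiset.mem_map_of_mem f (Finset.mem_univ i))
  rw [hf] at ha
  obtain ⟨j, -, hj⟩ := Multiset.mem_map.1 ha
  have h2 : (f i).re ≤ a := by simpa [hj] using hi j
  rcases re_pos_or_eq_zero_of_norm_sub_le (z := f i - a) (c := c - a) (by
    push_cast; rwa [sub_sub_sub_cancel_right]) with h | h
  · simp only [Complex.sub_re, Complex.ofReal_re] at h
    linarith
  · rw [sub_eq_zero.1 h, Complex.ofReal_im]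

end RiccatiM

/-- `Φ` and `Ψ` are the minimal nonnegative solutions of `X C X - X D - A X + B = 0` and of the dual
equation `Y B Y - Y A - D Y + C = 0`; `ev` is any arrangement of the eigenvalues of `H` by
descending real part. Indices start at `0`, so the `n`-th eigenvalue is `ev i` with `i + 1 = n` and
the `(n + 1)`-st is `ev i` with `i = n`. -/
theorem mainTheorem2 (n m : ℕ) (A : Matrix (Fin m) (Fin m) ℝ) (B : Matrix (Fin m) (Fin n) ℝ)
    (C : Matrix (Fin n) (Fin m) ℝ) (D : Matrix (Fin n) (Fin n) ℝ)
    (hK : RiccatiM.IsRegularMMatrix (Matrix.fromBlocks D (-C) (-B) A)) :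
    ∃ (Φ : Matrix (Fin m) (Fin n) ℝ) (Ψ : Matrix (Fin n) (Fin m) ℝ),
      RiccatiM.IsMinimalNonnegSolution A B C D Φ ∧
      RiccatiM.IsMinimalNonnegSolution D C B A Ψ ∧
      ∀ ev : Fin (n + m) → ℂ,
        Antitone (fun i => (ev i).re) →
        Multiset.map ev Finset.univ.val =
          RiccatiM.eigenvalueMultiset (Matrix.fromBlocks D (-C) B (-A)) →
        RiccatiM.eigenvalueMultiset (D - C * Φ) =
          Multiset.map (fun i : Fin n => ev (Fin.castAdd m i)) Finset.univ.val ∧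
        RiccatiM.eigenvalueMultiset (A - B * Ψ) =
          Multiset.map (fun j : Fin m => -ev (Fin.natAdd n j)) Finset.univ.val ∧
        (∀ i : Fin (n + m), (i : ℕ) + 1 = n → (ev i).im = 0) ∧
        (∀ i : Fin (n + m), (i : ℕ) = n → (ev i).im = 0) := by
  obtain ⟨⟨hZ, -⟩, v, hv, hKv⟩ := hK
  have hD : RiccatiM.IsZMatrix D := fun i j hij => hZ (Sum.inl i) (Sum.inl j) (by simpa using hij)
  have hA : RiccatiM.IsZMatrix A := fun i j hij => hZ (Sum.inr i) (Sum.inr j) (by simpa using hij)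
  have hC : ∀ i j, 0 ≤ C i j := fun i j => by simpa using hZ (Sum.inl i) (Sum.inr j) (by simp)
  have hB : ∀ i j, 0 ≤ B i j := fun i j => by simpa using hZ (Sum.inr i) (Sum.inl j) (by simp)
  have hv₁ : ∀ i, 0 < (v ∘ Sum.inl) i := fun i => hv _
  have hv₂ : ∀ i, 0 < (v ∘ Sum.inr) i := fun i => hv _
  rw [Matrix.fromBlocks_mulVec] at hKv
  have h₁ : ∀ i, (C.mulVec (v ∘ Sum.inr)) i ≤ (D.mulVec (v ∘ Sum.inl)) i := fun i => by
    have := hKv (Sum.inl i)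
    simp only [Sum.elim_inl, Matrix.neg_mulVec, Pi.add_apply, Pi.neg_apply] at this
    linarith
  have h₂ : ∀ i, (B.mulVec (v ∘ Sum.inl)) i ≤ (A.mulVec (v ∘ Sum.inr)) i := fun i => by
    have := hKv (Sum.inr i)
    simp only [Sum.elim_inr, Matrix.neg_mulVec, Pi.add_apply, Pi.neg_apply] at this
    linarith
  obtain ⟨Φ, hΦ0, hΦ, hΦmin, hΦZ, hΦD, hΦA⟩ :=
    RiccatiM.exists_minimal_solution hA hD hB hC hv₁ hv₂ h₁ h₂
  obtain ⟨Ψ, hΨ0, hΨ, hΨmin, hΨZ, hΨA, hΨD⟩ :=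
    RiccatiM.exists_minimal_solution hD hA hC hB hv₂ hv₁ h₂ h₁
  refine ⟨Φ, Ψ, ⟨⟨hΦ0, hΦ⟩, fun Y hY => hΦmin Y hY.1 hY.2⟩,
    ⟨⟨hΨ0, hΨ⟩, fun Y hY => hΨmin Y hY.1 hY.2⟩, fun ev hev hH => ?_⟩
  have hneg : ∀ R : Multiset ℂ, (∀ z ∈ R, 0 < z.re ∨ z = 0) →
      ∀ z ∈ R.map fun z => -z, z.re < 0 ∨ z = 0 := fun R hR z hz => by
    obtain ⟨w, hw, rfl⟩ := Multiset.mem_map.1 hz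
    simpa using hR w hw
  have hHΦ := RiccatiM.eigenvalueMultiset_of_solution hΦ
  have hHΨ := RiccatiM.eigenvalueMultiset_of_dual_solution hΨ
  have hcard : Multiset.card (RiccatiM.eigenvalueMultiset (D - C * Φ)) = n := by
    rw [RiccatiM.card_eigenvalueMultiset, Fintype.card_fin]
  have hAΨ := (RiccatiM.eq_and_eq_of_add_eq_add (hHΦ.symm.trans hHΨ)
    (by rw [hcard, RiccatiM.card_eigenvalueMultiset, Fintype.card_fin])
    hΦD hΨD (hneg _ hΦA) (hneg _ hΨA)).2
  rw [hHΦ, hAΨ] at hH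
  obtain ⟨e₁, e₂⟩ := RiccatiM.map_antitone_eq hev hH hcard
    (by rw [Multiset.card_map, RiccatiM.card_eigenvalueMultiset, Fintype.card_fin])
    hΦD (hneg _ hΨA)
  replace e₂ := congrArg (Multiset.map fun z : ℂ => -z) e₂
  simp only [Multiset.map_map, Function.comp_def, neg_neg, Multiset.map_id'] at e₂
  refine ⟨e₁, e₂, fun i hi => ?_, fun i hi => ?_⟩
  · have hlast := hΦZ.im_eq_zero e₁ (i := ⟨i, by omega⟩) fun j => hev (by
      rw [Fin.le_def]
      simp only [Fin.val_castAdd]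
      omega)
    exact hlast
  · have hi' : Fin.natAdd n (⟨0, by omega⟩ : Fin m) = i := Fin.ext (by simp [hi])
    have hfirst := hΨZ.im_eq_zero e₂ (i := ⟨0, by omega⟩) fun j => by
      have := hev (show Fin.natAdd n (⟨0, by omega⟩ : Fin m) ≤ Fin.natAdd n j by
        rw [Fin.le_def]
        simp)
      simpa using this
    rw [hi', Complex.neg_im, neg_eq_zero] at hfirst
    exact hfirst
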